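/- Consider the plant $$\dot x=Ax+Bu+Ep(q)+E_ww,\qquad y=Cx+Du+F_ww,\qquad q=C_qx,$$ with $x\in\mathbb R^{n_x}$, $u\in\mathbb R^{n_u}$, $y\in\mathbb R^{n_y}$, $w\in\mathbb R^{n_w}$, constant real matrices, and a globally Lipschitz continuous $p:\mathbb R^{n_q}\to\mathbb R^{n_p}$ with $p(0)=0$; let $\omega_0>0$. Consider the observer $$\dot{\hat x}=A\hat x+Bu+Ep(\hat q+L_1(\hat y-y))+L_2(\hat y-y),\qquad \hat y=C\hat x+Du,\qquad \hat q=C_q\hat x,$$ and the feedback law $k(x)=K_1x+K_2p(C_qx)$. Put $e=x-\hat x$, $z=(x,e)$, $\|z\|^2=\|x\|^2+\|e\|^2$. Suppose that there are $\alpha_0>0$, $\mu>0$, a symmetric positive definite matrix $P$ and matrices $K_1,K_2,L_1,L_2$ such that the continuous-time closed loop $\dot z=f(z,w)$ obtained with $u=k(\hat x)$ satisfies, for $V(z)=z^\top Pz$, $$\nabla V(z)\,f(z,w)\le-\alpha_0V(z)+\mu\|w\|^2\qquad\text{for all } z \text{ and all } w \text{ with } \|w\|\le\omega_0 .$$ Event-triggered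 implementation, with parameters $\tau,\sigma,\varepsilon>0$: $t_0=0$, the control is held constant, $u(t)=k(\hat x(t_k))$ for $t\in[t_k,t_{k+1})$, and $$t_{k+1}=\inf\{t\ge t_k+\tau:\ \|\hat x(t_k)-\hat x(t)\|>\sigma\|\hat x(t)\|+\varepsilon\},$$ where in this rule $\hat x$ evolves under the held control $u\equiv k(\hat x(t_k))$ and $t_{k+1}=\infty$ if the set is empty. Then $\tau,\sigma,\varepsilon$ can be chosen such that the event-triggered closed loop is ISpS with respect to $w$. More precisely, there is $\sigma_0>0$ such that for every $\sigma\in(0,\sigma_0]$ and every $\varepsilon>0$ there is $\tau_0>0$ such that for every $\tau\in(0,\tau_0]$ the following holds. 1. (Input-to-state practical stability.) There are $\beta_1\in\mathcal{KL}$, $\beta_2\in\mathcal K$ and $d\ge0$ such that for every initial state $z_0$ and every measurable $w$ with $\|w\|_\infty:=\sup_{t\ge0}\|w(t)\|\le\omega_0$, a trajectory of the event-triggered closed loop with $z(0)=z_0$ exists on $[0,\infty)$, and every such trajectory satisfies $$\|z(t)\|\le\beta_1(\|z_0\|,t)+\beta_2(\|w\|_\infty)+d\qquad\text{for all }t\ge0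 .$$ 2. (No Zeno behaviour.) Along every trajectory, $t_{k+1}\ge t_k+\tau$ for all $k$, and $t_k\to\infty$. -/

import Mathlib

open Set Filter Topology MeasureTheory

noncomputable section

/-- Real column vectors with the Euclidean norm. -/
abbrev Vec (n : ℕ) : Type := EuclideanSpace ℝ (Fin n)

/-- Vectors `z = (x, e)` made of a plant state `x` and an estimation error `e = x - x̂`,
with the Euclidean norm `‖z‖² = ‖x‖² + ‖e‖²`. -/
abbrev JointState (n : ℕ) : Type := EuclideanSpace ℝ (Fin n ⊕ Fin n)

namespace JointState

variable {n : ℕ}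

/-- The joint state `(x, e)`. -/
def stack (x e : Vec n) : JointState n := WithLp.toLp 2 (Sum.elim x.ofLp e.ofLp)

/-- The plant state `x` of `z = (x, e)`. -/
def plant (z : JointState n) : Vec n := WithLp.toLp 2 (fun i => z (Sum.inl i))

/-- The estimation error `e` of `z = (x, e)`. -/
def err (z : JointState n) : Vec n := WithLp.toLp 2 (fun i => z (Sum.inr i))

/-- The observer state `x̂ = x - e` of `z = (x, e)`. -/
def est (z : JointState n) : Vec n := plant z - err z

end JointState

/-- The product of a matrix and a Euclidean column vector. -/
def Matrix.act {m n : ℕ} (M : Matrix (Fin m) (Fin n) ℝ) (v : Vec n) : Vec m :=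
  WithLp.toLp 2 (M.mulVec v.ofLp)

/-- The data of the plant
`ẋ = A x + B u + E p(q) + E_w w`, `y = C x + D u + F_w w`, `q = C_q x`. -/
structure Plant (nx nu ny nq np nw : ℕ) where
  A : Matrix (Fin nx) (Fin nx) ℝ
  B : Matrix (Fin nx) (Fin nu) ℝ
  C : Matrix (Fin ny) (Fin nx) ℝ
  D : Matrix (Fin ny) (Fin nu) ℝ
  Cq : Matrix (Fin nq) (Fin nx) ℝ
  E : Matrix (Fin nx) (Fin np) ℝ
  Ew : Matrix (Fin nx) (Fin nw) ℝ
  Fw : Matrix (Fin ny) (Fin nw) ℝ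
  p : Vec nq → Vec np

/-- The controller gains `K₁, K₂` and the observer gains `L₁, L₂`. -/
structure Gains (nx nu ny nq np : ℕ) where
  K₁ : Matrix (Fin nu) (Fin nx) ℝ
  K₂ : Matrix (Fin nu) (Fin np) ℝ
  L₁ : Matrix (Fin nq) (Fin ny) ℝ
  L₂ : Matrix (Fin nx) (Fin ny) ℝ

section ClosedLoop

variable {nx nu ny nq np nw : ℕ}

/-- Right-hand side of the plant equation. -/
def Plant.field (S : Plant nx nu ny nq np nw) (x : Vec nx) (u : Vec nu) (w : Vec nw) : Vec nx :=
  S.A.act x + S.B.act u + S.E.act (S.p (S.Cq.act x)) + S.Ew.act w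

/-- Measured output of the plant. -/
def Plant.output (S : Plant nx nu ny nq np nw) (x : Vec nx) (u : Vec nu) (w : Vec nw) : Vec ny :=
  S.C.act x + S.D.act u + S.Fw.act w

/-- Right-hand side of the observer
`x̂' = A x̂ + B u + E p(q̂ + L₁ (ŷ - y)) + L₂ (ŷ - y)`, `ŷ = C x̂ + D u`, `q̂ = C_q x̂`. -/
def observerField (S : Plant nx nu ny nq np nw) (G : Gains nx nu ny nq np)
    (xhat : Vec nx) (u : Vec nu) (y : Vec ny) : Vec nx :=
  let yhat : Vec ny := S.C.act xhat + S.D.act u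
  S.A.act xhat + S.B.act u + S.E.act (S.p (S.Cq.act xhat + G.L₁.act (yhat - y)))
    + G.L₂.act (yhat - y)

/-- The feedback law `k(x) = K₁ x + K₂ p(C_q x)`. -/
def feedback (S : Plant nx nu ny nq np nw) (G : Gains nx nu ny nq np) (x : Vec nx) : Vec nu :=
  G.K₁.act x + G.K₂.act (S.p (S.Cq.act x))

/-- Plant and observer together, in the coordinates `z = (x, x - x̂)`, under the control
value `u` and the disturbance value `w`. -/
def jointField (S : Plant nx nu ny nq np nw) (G : Gains nx nu ny nq np)
    (u : Vec nu) (z : JointState nx) (w : Vec nw) : JointState nx :=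
  JointState.stack (S.field z.plant u w)
    (S.field z.plant u w - observerField S G z.est u (S.output z.plant u w))

/-- The continuous-time closed loop: `u = k(x̂)` at every instant. -/
def closedLoopField (S : Plant nx nu ny nq np nw) (G : Gains nx nu ny nq np)
    (z : JointState nx) (w : Vec nw) : JointState nx :=
  jointField S G (feedback S G z.est) z w

end ClosedLoop

/-- `V(z) = zᵀ P z`. -/
def quadForm {n : ℕ} (P : Matrix (Fin n ⊕ Fin n) (Fin n ⊕ Fin n) ℝ) (z : JointState n) : ℝ :=
  z.ofLp ⬝ᵥ P.mulVec z.ofLp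

/-- `z` is a (Carathéodory) solution of `ż(s) = F(s, z(s))` on `[a, ∞)`, with `F` allowed to be
merely measurable in time: `z` is on `[a, ∞)` the integral of the locally integrable function
`s ↦ F(s, z(s))`. -/
def SolvesFrom {Z : Type*} [NormedAddCommGroup Z] [NormedSpace ℝ Z]
    (F : ℝ → Z → Z) (a : ℝ) (z : ℝ → Z) : Prop :=
  ∀ b : ℝ, a ≤ b →
    IntervalIntegrable (fun s => F s (z s)) volume a b ∧ z b = z a + ∫ s in a..b, F s (z s)

/-- The mixed triggering rule. After an update at time `a`, with held value `xs = x̂(a)` and with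
`xhat` the observer state evolving under that held value, the next update takes place at
`inf {s | s ≥ a + τ, ‖xs - xhat(s)‖ > σ ‖xhat(s)‖ + ε}`, which is `⊤` if there is no such `s`. -/
def nextTrigger {n : ℕ} (τ σ ε a : ℝ) (xs : Vec n) (xhat : ℝ → Vec n) : EReal :=
  sInf ((fun s : ℝ => (s : EReal)) '' {s : ℝ | a + τ ≤ s ∧ σ * ‖xhat s‖ + ε < ‖xs - xhat s‖})

/-- `z` is on `[0, ∞)` a trajectory, with triggering times `t 0, t 1, …`, of the event-triggered
closed loop under the disturbance `w`. If `t k = a` is finite, then the control value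
`k(x̂(a))` is applied from time `a` on, which yields a solution `ζ k` of the plant and observer
equations starting at `z(a)`; the next triggering time is determined along `ζ k`, and `z` agrees
with `ζ k` up to that time. The value `t k = ⊤` means that there is no `k`-th update. -/
def IsEventTriggeredTrajectory {nx nu ny nq np nw : ℕ}
    (S : Plant nx nu ny nq np nw) (G : Gains nx nu ny nq np) (τ σ ε : ℝ)
    (w : ℝ → Vec nw) (z : ℝ → JointState nx) (t : ℕ → EReal) : Prop :=
  t 0 = 0 ∧ (∀ k, t k = ⊤ → t (k + 1) = ⊤) ∧
    ∃ ζ : ℕ → ℝ → JointState nx, ∀ (k : ℕ) (a : ℝ), t k = (a : EReal) →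
      ζ k a = z a ∧
      SolvesFrom (fun s y => jointField S G (feedback S G (z a).est) y (w s)) a (ζ k) ∧
      t (k + 1) = nextTrigger τ σ ε a (z a).est (fun s => (ζ k s).est) ∧
      ∀ s : ℝ, a ≤ s → (s : EReal) ≤ t (k + 1) → z s = ζ k s

/-- Class `𝒦` functions on `[0, ∞)`. -/
def IsClassK (β : ℝ → ℝ) : Prop :=
  ContinuousOn β (Ici 0) ∧ StrictMonoOn β (Ici 0) ∧ β 0 = 0

/-- Class `𝒦ℒ` functions on `[0, ∞) × [0, ∞)`. -/
def IsClassKL (β : ℝ → ℝ → ℝ) : Prop :=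
  ContinuousOn (fun q : ℝ × ℝ => β q.1 q.2) (Ici 0 ×ˢ Ici 0) ∧
    (∀ s, 0 ≤ s → IsClassK (fun r => β r s)) ∧
    ∀ r, 0 ≤ r → AntitoneOn (β r) (Ici 0) ∧ Tendsto (β r) atTop (𝓝 0)

/-- `‖w‖_∞ = sup_{t ≥ 0} ‖w(t)‖`, for bounded `w`. -/
def supNorm {W : Type*} [NormedAddCommGroup W] (w : ℝ → W) : ℝ :=
  sSup ((fun s => ‖w s‖) '' Ici 0)

/-- Measurable disturbances with `‖w‖_∞ ≤ ω₀`. -/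
def boundedDisturbances (nw : ℕ) (ω₀ : ℝ) : Set (ℝ → Vec nw) :=
  {w | Measurable w ∧ ∀ s, 0 ≤ s → ‖w s‖ ≤ ω₀}

/-- Input-to-state practical stability of a system given by its trajectories (`traj w z`: the
function `z` is on `[0, ∞)` a trajectory under the input `w`), with respect to bounded inputs in
`U`. From every initial state and for every input a trajectory exists for all `t ≥ 0`, and
every such trajectory obeys `‖z(t)‖ ≤ β₁(‖z(0)‖, t) + β₂(‖w‖_∞) + d`. -/
def IsISpS {Z W : Type*} [NormedAddCommGroup Z] [NormedAddCommGroup W]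
    (U : Set (ℝ → W)) (traj : (ℝ → W) → (ℝ → Z) → Prop) : Prop :=
  ∃ (β₁ : ℝ → ℝ → ℝ) (β₂ : ℝ → ℝ) (d : ℝ), IsClassKL β₁ ∧ IsClassK β₂ ∧ 0 ≤ d ∧
    ∀ z₀ : Z, ∀ w ∈ U,
      (∃ z : ℝ → Z, z 0 = z₀ ∧ traj w z) ∧
      ∀ z : ℝ → Z, z 0 = z₀ → traj w z →
        ∀ s, 0 ≤ s → ‖z s‖ ≤ β₁ ‖z₀‖ s + β₂ (supNorm w) + d

end

/-! Between two updates the loop is the continuous-time closed loop with the held value `x̂(t_k)` in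
place of `x̂(s)` inside the feedback. It therefore suffices to bound this mismatch by `δ‖z(s)‖ + ε`
with `δ` proportional to `σ`. After the waiting time `τ`, the triggering rule itself gives the
bound. During the waiting time the rule is inactive; there the linear growth of the field shows that
the state drifts by at most `O(τ)(‖z(s)‖ + ω₀)`, which is small enough once `τ` is small relative to
`σ` and `ε` (`norm_est_sub_le_of_lt_nextTrigger`).

Such a mismatch costs half of the dissipation rate and adds a constant of order `ε²`
(`dissipation_of_perturbed`). Hence `V - κ/c`, with `c = α₀/2`, decays by the factor `exp(-c Δt)` on
each interval (`SolvesFrom.exp_decay`). The state does not jump at updates and `t_k ≥ kτ`, so the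
factors multiply up over the whole half-line; square roots then give the ISpS estimate. Existence
comes from a contraction argument on each piece, followed by concatenation. -/

/-! ### Carathéodory solutions: existence, regularity, decay -/

/-- Estimate in the exponentially weighted sup norm: integration gains a factor `1 / l`, so a large
weight turns the Picard operator into a contraction on the entire half-line. -/
theorem norm_exp_smul_integral_le {Z : Type*} [NormedAddCommGroup Z] [NormedSpace ℝ Z]
    {f : ℝ → Z} {C l a m : ℝ} (hl : 0 < l) (hC : 0 ≤ C) (ham : a ≤ m)
    (hf : ∀ r, a ≤ r → ‖f r‖ ≤ C * Real.exp (l * (r - a))) :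
    ‖Real.exp (-(l * (m - a))) • ∫ r in a..m, f r‖ ≤ C / l := by
  have hprim : ∀ r ∈ uIcc a m, HasDerivAt (fun r => C / l * Real.exp (l * (r - a)))
      (C * Real.exp (l * (r - a))) r := by
    intro r _
    have h := ((((hasDerivAt_id r).sub_const a).const_mul l).exp).const_mul (C / l)
    convert! h using 1
    simp only [id]
    field_simp
  have hint : IntervalIntegrable (fun r => C * Real.exp (l * (r - a))) volume a m :=
    Continuous.intervalIntegrable (by fun_prop) _ _
  have h1 : ‖∫ r in a..m, f r‖ ≤ ∫ r in a..m, C * Real.exp (l * (r - a)) :=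
    intervalIntegral.norm_integral_le_of_norm_le ham
      (Eventually.of_forall fun r hr => hf r hr.1.le) hint
  rw [intervalIntegral.integral_eq_sub_of_hasDerivAt hprim hint] at h1
  rw [norm_smul, Real.norm_of_nonneg (Real.exp_pos _).le]
  have h2 : ‖∫ r in a..m, f r‖ ≤ C / l * Real.exp (l * (m - a)) := by
    refine h1.trans (sub_le_self _ (by positivity))
  calc Real.exp (-(l * (m - a))) * ‖∫ r in a..m, f r‖
      ≤ Real.exp (-(l * (m - a))) * (C / l * Real.exp (l * (m - a))) := by gcongr
    _ = C / l * (Real.exp (-(l * (m - a))) * Real.exp (l * (m - a))) := by ring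
    _ = C / l := by rw [← Real.exp_add]; simp

/-- Global existence of Carathéodory solutions for right-hand sides that are Lipschitz in the
state, uniformly in time. -/
theorem exists_solvesFrom {Z : Type*} [NormedAddCommGroup Z] [NormedSpace ℝ Z] [CompleteSpace Z]
    (F : ℝ → Z → Z) (a : ℝ) (z₀ : Z) (K : NNReal) (M : ℝ)
    (hmeas : ∀ z : ℝ → Z, Continuous z → AEStronglyMeasurable (fun s => F s (z s)) volume)
    (hLip : ∀ s, a ≤ s → LipschitzWith K (F s)) (hbd : ∀ s, a ≤ s → ‖F s 0‖ ≤ M) :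
    ∃ ζ : ℝ → Z, ζ a = z₀ ∧ SolvesFrom F a ζ := by
  -- Any weight above `K` works; this one gives the contraction factor `K / (K + 1)`.
  set l : ℝ := K + 1 with hl_def
  have hl : 0 < l := by positivity
  have hM : 0 ≤ M := (norm_nonneg _).trans (hbd a le_rfl)
  -- The unknown is the rescaled solution `g`, which stays bounded; `lift g` is the solution
  -- candidate itself.
  let lift : BoundedContinuousFunction ℝ Z → ℝ → Z := fun g s => Real.exp (l * (s - a)) • g s
  have hliftc : ∀ g, Continuous (lift g) := fun g => by
    have := g.continuous
    fun_prop
  have hgrow : ∀ g r, a ≤ r →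
      ‖F r (lift g r)‖ ≤ (M + K * ‖g‖) * Real.exp (l * (r - a)) := by
    intro g r hr
    have h1 : ‖F r (lift g r) - F r 0‖ ≤ K * ‖lift g r‖ := by
      simpa using (hLip r hr).norm_sub_le (lift g r) 0
    have h2 : ‖lift g r‖ ≤ Real.exp (l * (r - a)) * ‖g‖ := by
      rw [norm_smul, Real.norm_of_nonneg (Real.exp_pos _).le]
      gcongr
      exact g.norm_coe_le_norm r
    have h3 : 1 ≤ Real.exp (l * (r - a)) :=
      Real.one_le_exp (mul_nonneg hl.le (sub_nonneg.2 hr))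
    calc ‖F r (lift g r)‖ ≤ ‖F r 0‖ + ‖F r (lift g r) - F r 0‖ := by
          simpa using norm_add_le (F r 0) (F r (lift g r) - F r 0)
      _ ≤ M * Real.exp (l * (r - a)) + K * (Real.exp (l * (r - a)) * ‖g‖) := by
          have h4 : M ≤ M * Real.exp (l * (r - a)) := le_mul_of_one_le_right hM h3
          have h5 : (K : ℝ) * ‖lift g r‖ ≤ K * (Real.exp (l * (r - a)) * ‖g‖) := by gcongr
          linarith [hbd r hr]
      _ = _ := by ring
  have hint : ∀ g b, a ≤ b → IntervalIntegrable (fun s => F s (lift g s)) volume a b := by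
    intro g b hab
    have hc : IntervalIntegrable (fun r => (M + K * ‖g‖) * Real.exp (l * (r - a))) volume a b :=
      Continuous.intervalIntegrable (by fun_prop) _ _
    refine hc.mono_fun' (hmeas _ (hliftc g)).restrict ?_
    filter_upwards [ae_restrict_mem measurableSet_uIoc] with r hr
    rw [uIoc_of_le hab] at hr
    exact hgrow g r hr.1.le
  let T : BoundedContinuousFunction ℝ Z → BoundedContinuousFunction ℝ Z := fun g =>
    BoundedContinuousFunction.ofNormedAddCommGroup
      -- Freezing time at `a` to the left of `a` gives a bounded continuous function on all of `ℝ`,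
      -- although `F` is controlled only on `[a, ∞)`.
      (fun s => Real.exp (-(l * (max s a - a))) • (z₀ + ∫ r in a..max s a, F r (lift g r)))
      (by
        have hI : Continuous fun s => ∫ r in a..max s a, F r (lift g r) := by
          refine continuous_iff_continuousAt.2 fun s => ?_
          have h1 : ContinuousOn (fun b => ∫ r in a..b, F r (lift g r)) (uIcc a (max s a + 1)) :=
            intervalIntegral.continuousOn_primitive_interval'
              (hint g (max s a + 1) (by linarith [le_max_right s a])) left_mem_uIcc
          rw [uIcc_of_le (by linarith [le_max_right s a])] at h1
          have hmax : Continuous fun s : ℝ => max s a := by fun_prop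
          have h2 := h1 (max s a) ⟨le_max_right _ _, by linarith⟩
          refine ContinuousWithinAt.tendsto h2 |>.comp ?_
          refine tendsto_nhdsWithin_iff.2 ⟨hmax.continuousAt, ?_⟩
          filter_upwards [hmax.continuousAt.eventually (gt_mem_nhds (lt_add_one (max s a)))] with y hy
          exact ⟨le_max_right _ _, le_of_lt hy⟩
        fun_prop)
      (‖z₀‖ + (M + K * ‖g‖) / l)
      (by
        intro s
        rw [smul_add]
        refine (norm_add_le _ _).trans (add_le_add ?_ ?_)
        · rw [norm_smul, Real.norm_of_nonneg (Real.exp_pos _).le]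
          refine mul_le_of_le_one_left (norm_nonneg _) (Real.exp_le_one_iff.2 ?_)
          have := mul_nonneg hl.le (sub_nonneg.2 (le_max_right s a))
          linarith
        · exact norm_exp_smul_integral_le hl (by positivity) (le_max_right _ _) (hgrow g))
  have hT : ∀ g s, T g s =
      Real.exp (-(l * (max s a - a))) • (z₀ + ∫ r in a..max s a, F r (lift g r)) := fun _ _ => rfl
  have hcontr : ContractingWith (K / (K + 1)) T := by
    refine ⟨?_, LipschitzWith.of_dist_le_mul fun g h => ?_⟩
    · rw [div_lt_one (by positivity)]
      exact lt_add_one K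
    · rw [dist_eq_norm, dist_eq_norm]
      refine (BoundedContinuousFunction.norm_le (by positivity)).2 fun s => ?_
      have has := le_max_right s a
      rw [BoundedContinuousFunction.coe_sub, Pi.sub_apply, hT, hT, ← smul_sub,
        add_sub_add_left_eq_sub, ← intervalIntegral.integral_sub (hint g _ has) (hint h _ has)]
      refine (norm_exp_smul_integral_le (C := K * ‖g - h‖) hl (by positivity) has
        fun r hr => ?_).trans (le_of_eq ?_)
      · refine ((hLip r hr).norm_sub_le _ _).trans ?_
        have : lift g r - lift h r = Real.exp (l * (r - a)) • (g - h) r := by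
          simp [lift, smul_sub]
        rw [this, norm_smul, Real.norm_of_nonneg (Real.exp_pos _).le, mul_assoc,
          mul_comm ‖g - h‖]
        gcongr
        exact (g - h).norm_coe_le_norm r
      · rw [hl_def]
        push_cast
        ring
  set g := ContractingWith.fixedPoint T hcontr with hg_def
  have hg : T g = g := hcontr.fixedPoint_isFixedPt
  have hsol : ∀ b, a ≤ b → lift g b = z₀ + ∫ r in a..b, F r (lift g r) := by
    intro b hab
    have h1 : g b = Real.exp (-(l * (b - a))) • (z₀ + ∫ r in a..b, F r (lift g r)) := by
      conv_lhs => rw [← hg, hT, max_eq_left hab]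
    change Real.exp (l * (b - a)) • g b = _
    rw [h1, smul_smul, ← Real.exp_add]
    simp
  have h0 : lift g a = z₀ := by simpa using hsol a le_rfl
  exact ⟨lift g, h0, fun b hab => ⟨hint g b hab, by rw [h0]; exact hsol b hab⟩⟩

theorem SolvesFrom.continuousOn {Z : Type*} [NormedAddCommGroup Z] [NormedSpace ℝ Z]
    {F : ℝ → Z → Z} {a : ℝ} {z : ℝ → Z} (h : SolvesFrom F a z) {b : ℝ} (hab : a ≤ b) :
    ContinuousOn z (Icc a b) := by
  have h1 := intervalIntegral.continuousOn_primitive_interval' (h b hab).1 left_mem_uIcc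
  rw [uIcc_of_le hab] at h1
  exact (continuousOn_const.add h1).congr fun s hs => (h s hs.1).2

theorem SolvesFrom.sub_eq_integral {Z : Type*} [NormedAddCommGroup Z] [NormedSpace ℝ Z]
    {F : ℝ → Z → Z} {a : ℝ} {z : ℝ → Z} (h : SolvesFrom F a z) {r s : ℝ} (hr : a ≤ r)
    (hs : a ≤ s) : z s - z r = ∫ x in r..s, F x (z x) := by
  rw [(h r hr).2, (h s hs).2, add_sub_add_left_eq_sub,
    intervalIntegral.integral_interval_sub_left (h s hs).1 (h r hr).1]

theorem SolvesFrom.lipschitzOnWith {Z : Type*} [NormedAddCommGroup Z] [NormedSpace ℝ Z]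
    {F : ℝ → Z → Z} {a b : ℝ} {z : ℝ → Z} (h : SolvesFrom F a z) {M : NNReal}
    (hM : ∀ s ∈ Icc a b, ‖F s (z s)‖ ≤ M) : LipschitzOnWith M z (Icc a b) := by
  refine LipschitzOnWith.of_dist_le_mul fun s hs r hr => ?_
  rw [dist_eq_norm, h.sub_eq_integral hr.1 hs.1, Real.dist_eq]
  exact intervalIntegral.norm_integral_le_of_norm_le_const fun x hx =>
    hM x (uIcc_subset_Icc hr hs (uIoc_subset_uIcc hx))

/-- A linear differential inequality for `V` along a Carathéodory solution gives exponential
decay of `V - κ / c`. -/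
theorem SolvesFrom.exp_decay {Z : Type*} [NormedAddCommGroup Z] [NormedSpace ℝ Z]
    [CompleteSpace Z] {F : ℝ → Z → Z} {a b : ℝ} {z : ℝ → Z} (h : SolvesFrom F a z) (hab : a ≤ b)
    {M : ℝ} (hM : ∀ s ∈ Icc a b, ‖F s (z s)‖ ≤ M) {V : Z → ℝ} (hV : ContDiff ℝ 1 V) {c κ : ℝ}
    (hc : 0 < c) (hd : ∀ s ∈ Ico a b, fderiv ℝ V (z s) (F s (z s)) ≤ -c * V (z s) + κ) :
    V (z b) - κ / c ≤ Real.exp (-(c * (b - a))) * (V (z a) - κ / c) := by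
  have hM0 : 0 ≤ M := (norm_nonneg _).trans (hM a ⟨le_rfl, hab⟩)
  have hz : LipschitzOnWith ⟨M, hM0⟩ z (Icc a b) := h.lipschitzOnWith hM
  have hcomp : IsCompact (z '' Icc a b) := isCompact_Icc.image_of_continuousOn (h.continuousOn hab)
  -- The solution is differentiable only almost everywhere. Lipschitz bounds make `V ∘ z` absolutely
  -- continuous, so that the sign of its derivative a.e. can be integrated.
  obtain ⟨KV, hKV⟩ := (hV.locallyLipschitz.locallyLipschitzOn
    (s := z '' Icc a b)).exists_lipschitzOnWith_of_compact hcomp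
  have hVz : LipschitzOnWith (KV * ⟨M, hM0⟩) (V ∘ z) (Icc a b) :=
    hKV.comp hz (mapsTo_image _ _)
  rw [← uIcc_of_le hab] at hVz
  let u : ℝ → ℝ := fun s => Real.exp (c * (s - a)) * ((V ∘ z) s - κ / c)
  have hconst : AbsolutelyContinuousOnInterval (fun _ : ℝ => κ / c) a b :=
    (LipschitzWith.const (κ / c)).lipschitzOnWith.absolutelyContinuousOnInterval
  have hexp : AbsolutelyContinuousOnInterval (fun s : ℝ => Real.exp (c * (s - a))) a b :=
    ContDiffOn.absolutelyContinuousOnInterval (by fun_prop)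
  have hu : AbsolutelyContinuousOnInterval u a b :=
    hexp.mul (hVz.absolutelyContinuousOnInterval.sub hconst)
  have hderiv : ∀ᵐ s, s ∈ Ioo a b → deriv u s ≤ 0 := by
    filter_upwards [(h b hab).1.ae_hasDerivAt_integral] with s hs hsab
    have h1 := hs (by rw [uIcc_of_le hab]; exact Ioo_subset_Icc_self hsab) a left_mem_uIcc
    have h2 : HasDerivAt z (F s (z s)) s := by
      refine (h1.const_add (z a)).congr_of_eventuallyEq ?_
      filter_upwards [Ioi_mem_nhds hsab.1] with r hr
      exact (h r (le_of_lt hr)).2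
    have h3 : HasDerivAt (V ∘ z) (fderiv ℝ V (z s) (F s (z s))) s :=
      ((hV.differentiable one_ne_zero) (z s)).hasFDerivAt.comp_hasDerivAt s h2
    have h4 : HasDerivAt (fun s : ℝ => Real.exp (c * (s - a))) (Real.exp (c * (s - a)) * c) s := by
      simpa using (((hasDerivAt_id s).sub_const a).const_mul c).exp
    have h5 := h4.mul (h3.sub_const (κ / c))
    have h6 : deriv u s = _ := h5.deriv
    rw [h6]
    have h7 := hd s ⟨hsab.1.le, hsab.2⟩
    have h8 : Real.exp (c * (s - a)) * c * ((V ∘ z) s - κ / c)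
        + Real.exp (c * (s - a)) * fderiv ℝ V (z s) (F s (z s))
        = Real.exp (c * (s - a)) * (c * V (z s) - κ + fderiv ℝ V (z s) (F s (z s))) := by
      simp only [Function.comp]
      field_simp
    rw [h8]
    exact mul_nonpos_of_nonneg_of_nonpos (Real.exp_pos _).le (by linarith)
  have hle : u b - u a ≤ 0 := by
    rw [← hu.integral_deriv_eq_sub, intervalIntegral.integral_of_le hab,
      integral_Ioc_eq_integral_Ioo]
    refine setIntegral_nonpos_ae measurableSet_Ioo hderiv
  have hua : u a = V (z a) - κ / c := by simp [u]
  have hub : V (z b) - κ / c = Real.exp (-(c * (b - a))) * u b := by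
    simp only [u, ← mul_assoc, ← Real.exp_add]
    simp
  rw [hub, ← hua]
  gcongr
  linarith

/-! ### Effect of holding the control: drift and perturbed dissipation -/

/-- While the held value `x` is used in place of `H (ζ s)`, the state drifts over a short time only
by a small multiple of its current norm and of the bound on the disturbance. -/
theorem SolvesFrom.norm_sub_le_of_short_time {X Z W : Type*} [NormedAddCommGroup X]
    [NormedSpace ℝ X] [NormedAddCommGroup Z] [NormedSpace ℝ Z] [NormedAddCommGroup W]
    {Ψ : X → Z → W → Z} {K : ℝ} (hK : 0 ≤ K)
    (hΨ : ∀ x z w, ‖Ψ x z w‖ ≤ K * (‖x‖ + ‖z‖ + ‖w‖)) {H : Z →L[ℝ] X} {w : ℝ → W} {a τ ω : ℝ}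
    {ζ : ℝ → Z} (hτ : 0 ≤ τ) (hτK : 4 * τ * K * (‖H‖ + 1) ≤ 1)
    (hw : ∀ s, a ≤ s → ‖w s‖ ≤ ω)
    (h : SolvesFrom (fun s y => Ψ (H (ζ a)) y (w s)) a ζ) {s : ℝ} (hs : s ∈ Icc a (a + τ)) :
    ‖ζ s - ζ a‖ ≤ 4 * τ * K * ((‖H‖ + 1) * ‖ζ s‖ + ω) := by
  have hab : a ≤ a + τ := by linarith
  have hω : 0 ≤ ω := (norm_nonneg _).trans (hw a le_rfl)
  obtain ⟨s₁, hs₁, hmax⟩ := isCompact_Icc.exists_isMaxOn (nonempty_Icc.2 hab)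
    (((h.continuousOn hab).sub (continuousOn_const (c := ζ a))).norm)
  have hmax' : ∀ r ∈ Icc a (a + τ), ‖ζ r - ζ a‖ ≤ ‖ζ s₁ - ζ a‖ := fun r hr => hmax hr
  set D := ‖ζ s₁ - ζ a‖ with hD
  have hD0 : 0 ≤ D := norm_nonneg _
  have hHa : ‖H (ζ a)‖ ≤ ‖H‖ * ‖ζ a‖ := H.le_opNorm _
  -- Integrate the growth bound up to the time of maximal drift, using `‖ζ r‖ ≤ ‖ζ a‖ + D`.
  have h1 : D ≤ K * ((‖H‖ + 1) * ‖ζ a‖ + D + ω) * τ := by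
    have h2 := intervalIntegral.norm_integral_le_of_norm_le_const
      (f := fun r => Ψ (H (ζ a)) (ζ r) (w r)) (a := a) (b := s₁)
      (C := K * ((‖H‖ + 1) * ‖ζ a‖ + D + ω)) (fun r hr => by
        rw [uIoc_of_le hs₁.1] at hr
        refine (hΨ _ _ _).trans (mul_le_mul_of_nonneg_left ?_ hK)
        have h3 : ‖ζ r‖ ≤ ‖ζ a‖ + D := by
          have := hmax' r ⟨hr.1.le, hr.2.trans hs₁.2⟩
          have h4 := norm_add_le (ζ a) (ζ r - ζ a)
          rw [add_sub_cancel] at h4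
          linarith
        have := hw r hr.1.le
        linarith)
    rw [← h.sub_eq_integral le_rfl hs₁.1, abs_of_nonneg (sub_nonneg.2 hs₁.1)] at h2
    refine h2.trans (mul_le_mul_of_nonneg_left (by linarith [hs₁.2]) (by positivity))
  have hKτ : 0 ≤ τ * K := mul_nonneg hτ hK
  have h4 : 4 * (τ * K) ≤ 1 := by
    have : 4 * (τ * K) * 1 ≤ 4 * (τ * K) * (‖H‖ + 1) :=
      mul_le_mul_of_nonneg_left (by linarith [norm_nonneg H]) (by positivity)
    nlinarith
  -- Passing from `‖ζ a‖` to the current norm costs another `D`. By the smallness of `τ`, all terms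
  -- in `D` on the right amount to at most `D / 2` and are absorbed.
  have h5 : ‖ζ a‖ ≤ ‖ζ s‖ + D := by
    have := hmax' s hs
    have h6 := norm_sub_le (ζ s) (ζ s - ζ a)
    rw [sub_sub_cancel] at h6
    linarith
  have h6 : τ * K * (‖H‖ + 1) * ‖ζ a‖ ≤ τ * K * (‖H‖ + 1) * (‖ζ s‖ + D) :=
    mul_le_mul_of_nonneg_left h5 (by positivity)
  have h7 : (4 * τ * K * (‖H‖ + 1)) * D ≤ 1 * D := mul_le_mul_of_nonneg_right hτK hD0
  have h8 : 4 * (τ * K) * D ≤ 1 * D := mul_le_mul_of_nonneg_right h4 hD0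
  refine (hmax' s hs).trans ?_
  have h9 : 0 ≤ τ * K * ω := by positivity
  have h10 : 0 ≤ τ * K * (‖H‖ + 1) * ‖ζ s‖ := by positivity
  linarith

/-- A dissipation inequality survives a small relative and a bounded absolute perturbation of the
first argument of the right-hand side. -/
theorem dissipation_of_perturbed {X Z W : Type*} [NormedAddCommGroup X] [NormedAddCommGroup Z]
    [NormedSpace ℝ Z] {Ψ : X → Z → W → Z} {K : ℝ} (hK : 0 ≤ K) {V : Z → ℝ} {m N α ν δ ε : ℝ}
    (hm : 0 < m) (hα : 0 < α) (hN : 0 ≤ N)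
    {x y : X} {z : Z} {w : W}
    (hΨ : ‖Ψ x z w - Ψ y z w‖ ≤ K * ‖x - y‖)
    (hVm : m * ‖z‖ ^ 2 ≤ V z) (hVN : ‖fderiv ℝ V z‖ ≤ N * ‖z‖)
    (hdiss : fderiv ℝ V z (Ψ y z w) ≤ -α * V z + ν)
    (hxy : ‖x - y‖ ≤ δ * ‖z‖ + ε) (hδ : 4 * (N * K * δ) ≤ α * m) :
    fderiv ℝ V z (Ψ x z w) ≤ -(α / 2) * V z + (ν + (N * K * ε) ^ 2 / (α * m)) := by
  have h1 : fderiv ℝ V z (Ψ x z w)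
      = fderiv ℝ V z (Ψ y z w) + fderiv ℝ V z (Ψ x z w - Ψ y z w) := by
    rw [← map_add, add_sub_cancel]
  have h2 : fderiv ℝ V z (Ψ x z w - Ψ y z w) ≤ N * ‖z‖ * (K * (δ * ‖z‖ + ε)) := by
    refine (le_abs_self _).trans (((fderiv ℝ V z).le_opNorm _).trans ?_)
    refine mul_le_mul hVN (hΨ.trans (mul_le_mul_of_nonneg_left hxy hK)) (norm_nonneg _)
      (by positivity)
  have h3 : 4 * (N * K * δ) * ‖z‖ ^ 2 ≤ α * m * ‖z‖ ^ 2 :=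
    mul_le_mul_of_nonneg_right hδ (by positivity)
  have hαm : 0 < α * m := by positivity
  -- Young's inequality. The relative and the absolute part of the mismatch each consume `α m ‖z‖² /
  -- 4`, together at most `(α / 2) V`.
  have h4 : N * K * ε * ‖z‖ ≤ α * m / 4 * ‖z‖ ^ 2 + (N * K * ε) ^ 2 / (α * m) := by
    have h5 : (N * K * ε) ^ 2 / (α * m) * (α * m) = (N * K * ε) ^ 2 := by field_simp
    set q := (N * K * ε) ^ 2 / (α * m)
    have h6 : 0 ≤ (α * m) * (α * m / 4 * ‖z‖ ^ 2 + q - N * K * ε * ‖z‖) := by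
      have : (α * m) * (α * m / 4 * ‖z‖ ^ 2 + q - N * K * ε * ‖z‖)
          = (α * m / 2 * ‖z‖ - N * K * ε) ^ 2 := by
        linear_combination h5
      rw [this]
      positivity
    have := nonneg_of_mul_nonneg_right h6 hαm
    linarith
  have h5 : α * (m * ‖z‖ ^ 2) ≤ α * V z := mul_le_mul_of_nonneg_left hVm hα.le
  rw [h1]
  nlinarith

/-! ### Triggering times, and passing from pieces to whole trajectories -/

theorem coe_add_le_nextTrigger {n : ℕ} (τ σ ε a : ℝ) (xs : Vec n) (xhat : ℝ → Vec n) :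
    ((a + τ : ℝ) : EReal) ≤ nextTrigger τ σ ε a xs xhat := by
  refine le_sInf ?_
  rintro _ ⟨s, hs, rfl⟩
  exact EReal.coe_le_coe_iff.2 hs.1

theorem norm_sub_le_of_lt_nextTrigger {n : ℕ} {τ σ ε a s : ℝ} {xs : Vec n} {xhat : ℝ → Vec n}
    (has : a + τ ≤ s) (hs : (s : EReal) < nextTrigger τ σ ε a xs xhat) :
    ‖xs - xhat s‖ ≤ σ * ‖xhat s‖ + ε := by
  by_contra! hlt
  have hmem : s ∈ {s : ℝ | a + τ ≤ s ∧ σ * ‖xhat s‖ + ε < ‖xs - xhat s‖} := ⟨has, hlt⟩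
  exact absurd (sInf_le (mem_image_of_mem _ hmem)) (not_le.2 hs)

section Trajectory

variable {nx nu ny nq np nw : ℕ} {S : Plant nx nu ny nq np nw} {G : Gains nx nu ny nq np}
  {τ σ ε : ℝ} {w : ℝ → Vec nw} {z : ℝ → JointState nx} {t : ℕ → EReal}

theorem nat_mul_le_of_dwell (h0 : t 0 = 0) (hstep : ∀ k, 0 ≤ t k → t k + (τ : EReal) ≤ t (k + 1))
    (hτ : 0 < τ) (k : ℕ) : ((k * τ : ℝ) : EReal) ≤ t k := by
  induction k with
  | zero => simp [h0]
  | succ k ih =>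
    have hk : 0 ≤ t k := le_trans (EReal.coe_nonneg.2 (by positivity)) ih
    refine le_trans ?_ (hstep k hk)
    have : (((k + 1 : ℕ) * τ : ℝ) : EReal) = ((k * τ : ℝ) : EReal) + (τ : EReal) := by
      rw [← EReal.coe_add]
      congr 1
      push_cast
      ring
    rw [this]
    exact add_le_add_left ih _

theorem tendsto_top_of_dwell (hτ : 0 < τ) (h : ∀ k : ℕ, ((k * τ : ℝ) : EReal) ≤ t k) :
    Tendsto t atTop (𝓝 ⊤) := by
  rw [EReal.tendsto_nhds_top_iff_real]
  intro x
  obtain ⟨N, hN⟩ := exists_nat_gt (x / τ)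
  filter_upwards [eventually_ge_atTop N] with k hk
  refine lt_of_lt_of_le (EReal.coe_lt_coe_iff.2 ?_) (h k)
  rw [div_lt_iff₀ hτ] at hN
  have : (N : ℝ) ≤ k := by exact_mod_cast hk
  nlinarith

theorem IsEventTriggeredTrajectory.dwell_of_nonneg
    (h : IsEventTriggeredTrajectory S G τ σ ε w z t) (k : ℕ) (hk : 0 ≤ t k) :
    t k + (τ : EReal) ≤ t (k + 1) := by
  obtain ⟨-, htop, ζ, hζ⟩ := h
  induction hx : t k with
  | bot => rw [hx] at hk; exact absurd hk (by simp)
  | top => rw [htop k hx]; exact le_top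
  | coe a =>
    rw [(hζ k a hx).2.2.1, ← EReal.coe_add]
    exact coe_add_le_nextTrigger _ _ _ _ _ _

theorem IsEventTriggeredTrajectory.nat_mul_le
    (h : IsEventTriggeredTrajectory S G τ σ ε w z t) (hτ : 0 < τ) (k : ℕ) :
    ((k * τ : ℝ) : EReal) ≤ t k :=
  nat_mul_le_of_dwell h.1 h.dwell_of_nonneg hτ k

theorem IsEventTriggeredTrajectory.nonneg
    (h : IsEventTriggeredTrajectory S G τ σ ε w z t) (hτ : 0 < τ) (k : ℕ) : 0 ≤ t k :=
  le_trans (EReal.coe_nonneg.2 (by positivity)) (h.nat_mul_le hτ k)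

/-- A decay estimate that holds between consecutive updates holds on the whole half-line. -/
theorem IsEventTriggeredTrajectory.exp_decay
    (h : IsEventTriggeredTrajectory S G τ σ ε w z t) (hτ : 0 < τ) {Y : JointState nx → ℝ} {c : ℝ}
    (hY : ∀ (a b : ℝ) (ζ : ℝ → JointState nx), 0 ≤ a → a ≤ b →
      SolvesFrom (fun s y => jointField S G (feedback S G (ζ a).est) y (w s)) a ζ →
      (b : EReal) ≤ nextTrigger τ σ ε a (ζ a).est (fun s => (ζ s).est) →
      Y (ζ b) ≤ Real.exp (-(c * (b - a))) * Y (ζ a)) {s : ℝ} (hs : 0 ≤ s) :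
    Y (z s) ≤ Real.exp (-(c * s)) * Y (z 0) := by
  have hnn := h.nonneg hτ
  have hdwell := h.dwell_of_nonneg
  have htend := tendsto_top_of_dwell hτ (h.nat_mul_le hτ)
  obtain ⟨h0, htop, ζ, hζ⟩ := h
  have hpiece : ∀ (k : ℕ) (a b : ℝ), t k = (a : EReal) → a ≤ b → (b : EReal) ≤ t (k + 1) →
      Y (z a) ≤ Real.exp (-(c * a)) * Y (z 0) → Y (z b) ≤ Real.exp (-(c * b)) * Y (z 0) := by
    intro k a b hk hab hb ha
    obtain ⟨h1, h2, h3, h4⟩ := hζ k a hk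
    have ha0 : 0 ≤ a := EReal.coe_nonneg.1 (hk ▸ hnn k)
    rw [← h1] at h2 h3
    have h5 := hY a b (ζ k) ha0 hab h2 (h3 ▸ hb)
    rw [← h4 b hab hb, h1] at h5
    -- Only positive exponentials are multiplied, so `Y` may be negative.
    calc Y (z b) ≤ Real.exp (-(c * (b - a))) * Y (z a) := h5
      _ ≤ Real.exp (-(c * (b - a))) * (Real.exp (-(c * a)) * Y (z 0)) := by gcongr
      _ = Real.exp (-(c * b)) * Y (z 0) := by
        rw [← mul_assoc, ← Real.exp_add]
        ring_nf
  have hmono : ∀ k, t k ≤ t (k + 1) := fun k =>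
    le_trans (le_add_of_nonneg_right (EReal.coe_nonneg.2 hτ.le)) (hdwell k (hnn k))
  have hnodes : ∀ (k : ℕ) (a : ℝ), t k = (a : EReal) →
      Y (z a) ≤ Real.exp (-(c * a)) * Y (z 0) := by
    intro k
    induction k with
    | zero =>
      intro a ha
      rw [h0] at ha
      have : a = 0 := by exact_mod_cast ha.symm
      simp [this]
    | succ k ih =>
      intro b hb
      induction hx : t k with
      | bot => exact absurd (hnn k) (by simp [hx])
      | top => rw [htop k hx] at hb; exact absurd hb (by simp)
      | coe a =>
        refine hpiece k a b hx ?_ hb.ge (ih a hx)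
        rw [← EReal.coe_le_coe_iff, ← hx, ← hb]
        exact hmono k
  -- The first update after `s` has a predecessor, since `t 0 = 0 ≤ s`; this locates `s` in some `[t
  -- j, t (j + 1))`.
  have hex : ∃ k, (s : EReal) < t k :=
    (htend.eventually (lt_mem_nhds (EReal.coe_lt_top s))).exists
  classical
  obtain ⟨j, hj⟩ : ∃ j, Nat.find hex = j + 1 := by
    refine Nat.exists_eq_succ_of_ne_zero fun h00 => ?_
    have := Nat.find_spec hex
    rw [h00, h0] at this
    exact absurd this (not_lt.2 (EReal.coe_nonneg.2 hs))
  have hlt : (s : EReal) < t (j + 1) := hj ▸ Nat.find_spec hex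
  have hle : t j ≤ s := not_lt.1 (Nat.find_min hex (by omega))
  induction hx : t j with
  | bot => exact absurd (hnn j) (by simp [hx])
  | top => rw [hx] at hle; exact absurd hle (by simp)
  | coe a =>
    exact hpiece j a s hx (EReal.coe_le_coe_iff.1 (hx ▸ hle)) hlt.le (hnodes j a hx)

/-- Solutions under held control values concatenate to an event-triggered trajectory. -/
theorem exists_isEventTriggeredTrajectory (hτ : 0 < τ)
    (hsol : ∀ (a : ℝ) (z₀ : JointState nx), 0 ≤ a → ∃ ζ : ℝ → JointState nx, ζ a = z₀ ∧
      SolvesFrom (fun s y => jointField S G (feedback S G z₀.est) y (w s)) a ζ)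
    (z₀ : JointState nx) :
    ∃ z : ℝ → JointState nx, z 0 = z₀ ∧ ∃ t, IsEventTriggeredTrajectory S G τ σ ε w z t := by
  classical
  choose! sol hsol0 hsolves using hsol
  -- The recursion runs on pairs (update time, state at that time). Once the time is `⊤`, the stored
  -- state is a junk value coming from `toReal`, and it is never used.
  let next : EReal × JointState nx → EReal := fun q =>
    if q.1 = ⊤ then ⊤ else
      nextTrigger τ σ ε q.1.toReal q.2.est (fun s => (sol q.1.toReal q.2 s).est)
  let step : EReal × JointState nx → EReal × JointState nx := fun q =>
    (next q, sol q.1.toReal q.2 (next q).toReal)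
  let q : ℕ → EReal × JointState nx := fun k => step^[k] (0, z₀)
  have hqs : ∀ k, q (k + 1) = step (q k) := fun k => Function.iterate_succ_apply' step k _
  let t : ℕ → EReal := fun k => (q k).1
  have ht0 : t 0 = 0 := rfl
  have htop : ∀ k, t k = ⊤ → t (k + 1) = ⊤ := by
    intro k hk
    change (q (k + 1)).1 = ⊤
    rw [hqs]
    exact if_pos hk
  have hnext : ∀ (k : ℕ) (a : ℝ), t k = (a : EReal) → t (k + 1) =
      nextTrigger τ σ ε a (q k).2.est (fun s => (sol a (q k).2 s).est) := by
    intro k a hk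
    have h1 : (q k).1 = a := hk
    change (q (k + 1)).1 = _
    rw [hqs]
    change next (q k) = _
    simp [next, h1]
  have hdwell : ∀ k, 0 ≤ t k → t k + (τ : EReal) ≤ t (k + 1) := by
    intro k hk
    induction hx : t k with
    | bot => rw [hx] at hk; exact absurd hk (by simp)
    | top => rw [htop k hx]; exact le_top
    | coe a =>
      rw [hnext k a hx, ← EReal.coe_add]
      exact coe_add_le_nextTrigger _ _ _ _ _ _
  have hmul := nat_mul_le_of_dwell ht0 hdwell hτ
  have hnn : ∀ k, 0 ≤ t k := fun k => le_trans (EReal.coe_nonneg.2 (by positivity)) (hmul k)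
  have hmono : Monotone t := monotone_nat_of_le_succ fun k =>
    le_trans (le_add_of_nonneg_right (EReal.coe_nonneg.2 hτ.le)) (hdwell k (hnn k))
  have hex : ∀ s : ℝ, ∃ k, (s : EReal) < t (k + 1) := fun s =>
    ((tendsto_top_of_dwell hτ hmul |>.comp (tendsto_add_atTop_nat 1)).eventually
      (lt_mem_nhds (EReal.coe_lt_top s))).exists
  let z : ℝ → JointState nx := fun s =>
    sol (t (Nat.find (hex s))).toReal (q (Nat.find (hex s))).2 s
  have hz : ∀ (k : ℕ) (a s : ℝ), t k = (a : EReal) → a ≤ s → (s : EReal) < t (k + 1) →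
      z s = sol a (q k).2 s := by
    intro k a s hk has hs
    have hfind : Nat.find (hex s) = k := by
      refine (Nat.find_eq_iff _).2 ⟨hs, fun j hj => not_lt.2 ?_⟩
      exact (hmono (Nat.succ_le_of_lt hj)).trans (hk ▸ EReal.coe_le_coe_iff.2 has)
    simp only [z, hfind, hk, EReal.toReal_coe]
  have hnode : ∀ (k : ℕ) (a : ℝ), t k = (a : EReal) → z a = (q k).2 := by
    intro k a hk
    have ha : 0 ≤ a := EReal.coe_nonneg.1 (hk ▸ hnn k)
    rw [hz k a a hk le_rfl, hsol0 a _ ha]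
    refine lt_of_lt_of_le ?_ (hdwell k (hnn k))
    rw [hk, ← EReal.coe_add]
    exact EReal.coe_lt_coe_iff.2 (by linarith)
  refine ⟨z, hnode 0 0 ht0, t, ht0, htop, fun k => sol (t k).toReal (q k).2, ?_⟩
  intro k a hk
  have ha : 0 ≤ a := EReal.coe_nonneg.1 (hk ▸ hnn k)
  simp only [hk, EReal.toReal_coe, hnode k a hk]
  refine ⟨hsol0 a _ ha, hsolves a _ ha, hnext k a hk, fun s has hs => ?_⟩
  -- At the right endpoint `z` already follows the next piece, whose initial state is the end value
  -- of the current one.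
  rcases hs.lt_or_eq with hlt | heq
  · exact hz k a s hk has hlt
  · rw [hnode (k + 1) s heq.symm, hqs]
    have h1 : (next (q k)) = (s : EReal) := by
      have : t (k + 1) = next (q k) := congrArg Prod.fst (hqs k)
      rw [← this, heq]
    have h2 : (q k).1 = a := hk
    change sol (q k).1.toReal (q k).2 (next (q k)).toReal = _
    rw [h1, h2, EReal.toReal_coe, EReal.toReal_coe]

end Trajectory

/-! ### Lipschitz continuity of the sampled field -/

/-- `Matrix.act` as a continuous linear map. -/
noncomputable def Matrix.actL {m n : ℕ} (M : Matrix (Fin m) (Fin n) ℝ) : Vec n →L[ℝ] Vec m :=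
  LinearMap.toContinuousLinearMap
    { toFun := M.act
      map_add' := fun x y => by ext i; simp [Matrix.act, Matrix.mulVec_add]
      map_smul' := fun c x => by ext i; simp [Matrix.act, Matrix.mulVec_smul] }

theorem Matrix.actL_apply {m n : ℕ} (M : Matrix (Fin m) (Fin n) ℝ) (v : Vec n) :
    M.actL v = M.act v := rfl

/-- `JointState.plant` as a continuous linear map. -/
noncomputable def JointState.plantL (n : ℕ) : JointState n →L[ℝ] Vec n :=
  LinearMap.toContinuousLinearMap
    { toFun := JointState.plant
      map_add' := fun x y => by ext i; simp [JointState.plant]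
      map_smul' := fun c x => by ext i; simp [JointState.plant] }

/-- `JointState.est` as a continuous linear map. -/
noncomputable def JointState.estL (n : ℕ) : JointState n →L[ℝ] Vec n :=
  LinearMap.toContinuousLinearMap
    { toFun := JointState.est
      map_add' := fun x y => by ext i; simp [JointState.est, JointState.plant, JointState.err]; ring
      map_smul' := fun c x => by
        ext i; simp [JointState.est, JointState.plant, JointState.err]; ring }

/-- `JointState.stack` as a continuous linear map. -/
noncomputable def JointState.stackL (n : ℕ) : Vec n × Vec n →L[ℝ] JointState n :=
  LinearMap.toContinuousLinearMap
    { toFun := fun q => JointState.stack q.1 q.2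
      map_add' := fun x y => by
        ext i; rcases i with i | i <;> simp [JointState.stack]
      map_smul' := fun c x => by
        ext i; rcases i with i | i <;> simp [JointState.stack] }

/-- Global Lipschitz continuity with an unspecified constant. -/
def IsLip {α β : Type*} [PseudoEMetricSpace α] [PseudoEMetricSpace β] (f : α → β) : Prop :=
  ∃ K : NNReal, LipschitzWith K f

namespace IsLip

variable {α β γ E : Type*} [PseudoEMetricSpace α] [PseudoEMetricSpace β] [PseudoEMetricSpace γ]
  [NormedAddCommGroup E]

theorem comp {g : β → γ} {f : α → β} (hg : IsLip g) (hf : IsLip f) : IsLip fun x => g (f x) := by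
  obtain ⟨K, hK⟩ := hg
  obtain ⟨L, hL⟩ := hf
  exact ⟨_, hK.comp hL⟩

theorem prodMk {g : α → γ} {f : α → β} (hf : IsLip f) (hg : IsLip g) :
    IsLip fun x => (f x, g x) := by
  obtain ⟨K, hK⟩ := hg
  obtain ⟨L, hL⟩ := hf
  exact ⟨_, hL.prodMk hK⟩

theorem clm {F : Type*} [NormedSpace ℝ E] [NormedAddCommGroup F] [NormedSpace ℝ F]
    (M : E →L[ℝ] F) {f : α → E} (hf : IsLip f) : IsLip fun x => M (f x) :=
  comp ⟨_, M.lipschitz⟩ hf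

theorem add {f g : α → E} (hf : IsLip f) (hg : IsLip g) : IsLip fun x => f x + g x := by
  obtain ⟨K, hK⟩ := hf
  obtain ⟨L, hL⟩ := hg
  exact ⟨_, hK.add hL⟩

theorem sub {f g : α → E} (hf : IsLip f) (hg : IsLip g) : IsLip fun x => f x - g x := by
  obtain ⟨K, hK⟩ := hf
  obtain ⟨L, hL⟩ := hg
  exact ⟨_, hK.sub hL⟩

end IsLip

section Field

variable {nx nu ny nq np nw : ℕ} (S : Plant nx nu ny nq np nw) (G : Gains nx nu ny nq np)

/-- The held value is a variable separate from the state. A single constant then serves for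
solvability, for linear growth and for sensitivity to the mismatch. -/
theorem isLip_jointField_feedback (hp : IsLip S.p) :
    IsLip fun q : Vec nx × JointState nx × Vec nw =>
      jointField S G (feedback S G q.1) q.2.1 q.2.2 := by
  have hx : IsLip fun q : Vec nx × JointState nx × Vec nw => q.1 := ⟨1, LipschitzWith.prod_fst⟩
  have h2 : IsLip fun q : Vec nx × JointState nx × Vec nw => q.2 := ⟨1, LipschitzWith.prod_snd⟩
  have hz : IsLip fun q : Vec nx × JointState nx × Vec nw => q.2.1 :=
    IsLip.comp ⟨1, LipschitzWith.prod_fst⟩ h2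
  have hw : IsLip fun q : Vec nx × JointState nx × Vec nw => q.2.2 :=
    IsLip.comp ⟨1, LipschitzWith.prod_snd⟩ h2
  have hplant : IsLip fun q : Vec nx × JointState nx × Vec nw => q.2.1.plant :=
    hz.clm (JointState.plantL nx)
  have hest : IsLip fun q : Vec nx × JointState nx × Vec nw => q.2.1.est :=
    hz.clm (JointState.estL nx)
  have hu : IsLip fun q : Vec nx × JointState nx × Vec nw => feedback S G q.1 :=
    (hx.clm G.K₁.actL).add ((hp.comp (hx.clm S.Cq.actL)).clm G.K₂.actL)
  have hfield : IsLip fun q : Vec nx × JointState nx × Vec nw =>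
      S.field q.2.1.plant (feedback S G q.1) q.2.2 :=
    (((hplant.clm S.A.actL).add (hu.clm S.B.actL)).add
      ((hp.comp (hplant.clm S.Cq.actL)).clm S.E.actL)).add (hw.clm S.Ew.actL)
  have hy : IsLip fun q : Vec nx × JointState nx × Vec nw =>
      S.output q.2.1.plant (feedback S G q.1) q.2.2 :=
    ((hplant.clm S.C.actL).add (hu.clm S.D.actL)).add (hw.clm S.Fw.actL)
  have hinnov : IsLip fun q : Vec nx × JointState nx × Vec nw =>
      S.C.act q.2.1.est + S.D.act (feedback S G q.1)
        - S.output q.2.1.plant (feedback S G q.1) q.2.2 :=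
    ((hest.clm S.C.actL).add (hu.clm S.D.actL)).sub hy
  have hobs : IsLip fun q : Vec nx × JointState nx × Vec nw =>
      observerField S G q.2.1.est (feedback S G q.1)
        (S.output q.2.1.plant (feedback S G q.1) q.2.2) :=
    (((hest.clm S.A.actL).add (hu.clm S.B.actL)).add
      ((hp.comp ((hest.clm S.Cq.actL).add (hinnov.clm G.L₁.actL))).clm S.E.actL)).add
      (hinnov.clm G.L₂.actL)
  exact (hfield.prodMk (hfield.sub hobs)).clm (JointState.stackL nx)

/-- Together with the Lipschitz bound this yields linear growth without a constant term, which is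
why the drift is relative to the state and the disturbance. -/
theorem jointField_feedback_zero (hp0 : S.p 0 = 0) :
    jointField S G (feedback S G 0) 0 0 = 0 := by
  have hest : (0 : JointState nx).est = 0 := map_zero (JointState.estL nx)
  have hplant : (0 : JointState nx).plant = 0 := map_zero (JointState.plantL nx)
  have hstack : JointState.stack (0 : Vec nx) 0 = 0 := map_zero (JointState.stackL nx)
  simp [jointField, feedback, Plant.field, Plant.output, observerField, ← Matrix.actL_apply,
    hest, hplant, hp0, hstack]

end Field

/-! ### Bounds for the quadratic Lyapunov function -/

section QuadForm

variable {n : ℕ} (P : Matrix (Fin n ⊕ Fin n) (Fin n ⊕ Fin n) ℝ)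

theorem quadForm_eq_inner (z : JointState n) :
    quadForm P z = inner ℝ z (Matrix.toEuclideanCLM (𝕜 := ℝ) P z) :=
  (Matrix.inner_toEuclideanCLM P z z).symm

theorem contDiff_quadForm : ContDiff ℝ 1 (quadForm P) := by
  rw [funext (quadForm_eq_inner P)]
  exact contDiff_id.inner ℝ (ContinuousLinearMap.contDiff _)

theorem norm_fderiv_quadForm_le (z : JointState n) :
    ‖fderiv ℝ (quadForm P) z‖
      ≤ 2 * ‖Matrix.toEuclideanCLM (n := Fin n ⊕ Fin n) (𝕜 := ℝ) P‖ * ‖z‖ := by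
  set T := Matrix.toEuclideanCLM (n := Fin n ⊕ Fin n) (𝕜 := ℝ) P with hT
  rw [funext (quadForm_eq_inner P)]
  have h := (hasFDerivAt_id (𝕜 := ℝ) z).inner ℝ (T.hasFDerivAt (x := z))
  refine ContinuousLinearMap.opNorm_le_bound _ (by positivity) fun v => ?_
  have h1 : fderiv ℝ (fun z => inner ℝ z (T z)) z v = inner ℝ z (T v) + inner ℝ v (T z) := by
    have h2 : fderiv ℝ (fun z => inner ℝ z (T z)) z = _ := h.fderiv
    rw [h2]
    simp
  rw [h1]
  calc ‖inner ℝ z (T v) + inner ℝ v (T z)‖ ≤ ‖z‖ * ‖T v‖ + ‖v‖ * ‖T z‖ :=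
        (norm_add_le _ _).trans (add_le_add (norm_inner_le_norm _ _) (norm_inner_le_norm _ _))
    _ ≤ ‖z‖ * (‖T‖ * ‖v‖) + ‖v‖ * (‖T‖ * ‖z‖) := by
        gcongr <;> exact T.le_opNorm _
    _ = 2 * ‖T‖ * ‖z‖ * ‖v‖ := by ring

theorem quadForm_le (z : JointState n) :
    quadForm P z ≤ ‖Matrix.toEuclideanCLM (n := Fin n ⊕ Fin n) (𝕜 := ℝ) P‖ * ‖z‖ ^ 2 := by
  set T := Matrix.toEuclideanCLM (n := Fin n ⊕ Fin n) (𝕜 := ℝ) P with hT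
  rw [quadForm_eq_inner]
  calc inner ℝ z (T z) ≤ ‖z‖ * ‖T z‖ := real_inner_le_norm _ _
    _ ≤ ‖z‖ * (‖T‖ * ‖z‖) := by gcongr; exact T.le_opNorm _
    _ = ‖T‖ * ‖z‖ ^ 2 := by ring

variable {P}

/-- By homogeneity `m` can be the minimum over the compact unit sphere; the sphere is empty in
dimension zero. -/
theorem exists_mul_norm_sq_le_quadForm (hP : P.PosDef) :
    ∃ m : ℝ, 0 < m ∧ ∀ z : JointState n, m * ‖z‖ ^ 2 ≤ quadForm P z := by
  have hpos : ∀ z : JointState n, z ≠ 0 → 0 < quadForm P z := fun z hz => by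
    have h : z.ofLp ≠ 0 := fun h => hz (by ext i; simp [h])
    have h1 := hP.dotProduct_mulVec_pos h
    rwa [star_trivial] at h1
  rcases (Metric.sphere (0 : JointState n) 1).eq_empty_or_nonempty with he | hne
  · refine ⟨1, one_pos, fun z => ?_⟩
    have hz : z = 0 := by
      by_contra hz
      have : ‖z‖⁻¹ • z ∈ Metric.sphere (0 : JointState n) 1 := by
        simp [norm_smul, inv_mul_cancel₀ (norm_ne_zero_iff.2 hz)]
      simp [he] at this
    simp [hz, quadForm_eq_inner]
  · obtain ⟨y, hy, hmin⟩ := (isCompact_sphere (0 : JointState n) 1).exists_isMinOn hne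
      (contDiff_quadForm P).continuous.continuousOn
    have hy0 : y ≠ 0 := by
      rintro rfl
      simp at hy
    refine ⟨quadForm P y, hpos y hy0, fun z => ?_⟩
    by_cases hz : z = 0
    · simp [hz, quadForm_eq_inner]
    have hmem : ‖z‖⁻¹ • z ∈ Metric.sphere (0 : JointState n) 1 := by
      simp [norm_smul, inv_mul_cancel₀ (norm_ne_zero_iff.2 hz)]
    have h1 : quadForm P y ≤ quadForm P (‖z‖⁻¹ • z) := hmin hmem
    have h2 : quadForm P (‖z‖⁻¹ • z) = ‖z‖⁻¹ * (‖z‖⁻¹ * quadForm P z) := by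
      rw [quadForm_eq_inner, quadForm_eq_inner, map_smul, real_inner_smul_left,
        real_inner_smul_right]
    have hz' : ‖z‖ ≠ 0 := norm_ne_zero_iff.2 hz
    calc quadForm P y * ‖z‖ ^ 2 ≤ ‖z‖⁻¹ * (‖z‖⁻¹ * quadForm P z) * ‖z‖ ^ 2 := by
          rw [← h2]; gcongr
      _ = quadForm P z := by field_simp

end QuadForm

/-! ### Comparison functions and the sampled loop -/

theorem norm_le_supNorm {W : Type*} [NormedAddCommGroup W] {w : ℝ → W} {ω : ℝ}
    (hw : ∀ s, 0 ≤ s → ‖w s‖ ≤ ω) {s : ℝ} (hs : 0 ≤ s) : ‖w s‖ ≤ supNorm w :=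
  le_csSup ⟨ω, by rintro _ ⟨r, hr, rfl⟩; exact hw r hr⟩ (mem_image_of_mem _ hs)

theorem supNorm_le {W : Type*} [NormedAddCommGroup W] {w : ℝ → W} {ω : ℝ}
    (hw : ∀ s, 0 ≤ s → ‖w s‖ ≤ ω) : supNorm w ≤ ω :=
  csSup_le (nonempty_Ici.image _) (by rintro _ ⟨r, hr, rfl⟩; exact hw r hr)

theorem isClassK_mul_left {c : ℝ} (hc : 0 < c) : IsClassK fun r => c * r :=
  ⟨by fun_prop, fun _ _ _ _ h => mul_lt_mul_of_pos_left h hc, by simp⟩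

theorem isClassKL_mul_exp {C c : ℝ} (hC : 0 < C) (hc : 0 < c) :
    IsClassKL fun r s => C * r * Real.exp (-(c * s)) := by
  refine ⟨by fun_prop, fun s _ => ?_, fun r hr => ⟨fun s _ s' _ h => ?_, ?_⟩⟩
  · have h := isClassK_mul_left (mul_pos hC (Real.exp_pos (-(c * s))))
    simpa only [mul_right_comm] using h
  · dsimp only
    gcongr
  · have h : Tendsto (fun s : ℝ => Real.exp (-(c * s))) atTop (𝓝 0) :=
      Real.tendsto_exp_neg_atTop_nhds_zero.comp (tendsto_id.const_mul_atTop hc)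
    simpa using h.const_mul (C * r)

section SampledLoop

variable {nx nu ny nq np nw : ℕ} {S : Plant nx nu ny nq np nw} {G : Gains nx nu ny nq np}

theorem exists_solvesFrom_heldInput (hp : IsLip S.p) {w : ℝ → Vec nw} {ω : ℝ} (hw : Measurable w)
    (hwω : ∀ s, 0 ≤ s → ‖w s‖ ≤ ω) (a : ℝ) (ha : 0 ≤ a) (x : Vec nx) (z₀ : JointState nx) :
    ∃ ζ : ℝ → JointState nx, ζ a = z₀ ∧
      SolvesFrom (fun s y => jointField S G (feedback S G x) y (w s)) a ζ := by
  obtain ⟨K, hK⟩ := isLip_jointField_feedback S G hp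
  refine exists_solvesFrom _ a z₀ K (‖jointField S G (feedback S G x) 0 0‖ + K * ω)
    (fun z hz => ?_) (fun s _ => LipschitzWith.of_dist_le_mul fun y y' => ?_) (fun s hs => ?_)
  · have hc : Continuous fun q : Vec nx × JointState nx × Vec nw =>
      jointField S G (feedback S G q.1) q.2.1 q.2.2 := hK.continuous
    have hm : Measurable fun s => (x, z s, w s) :=
      measurable_const.prodMk (hz.measurable.prodMk hw)
    exact (hc.measurable.comp hm).aestronglyMeasurable
  · simpa [Prod.dist_eq] using hK.dist_le_mul (x, y, w s) (x, y', w s)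
  · have h1 := hK.norm_sub_le (x, 0, w s) (x, 0, 0)
    have h2 : ‖((x, 0, w s) : Vec nx × JointState nx × Vec nw) - (x, 0, 0)‖ = ‖w s‖ := by
      simp [Prod.norm_def]
    rw [h2] at h1
    have h3 := norm_add_le (jointField S G (feedback S G x) 0 0)
      (jointField S G (feedback S G x) 0 (w s) - jointField S G (feedback S G x) 0 0)
    rw [add_sub_cancel] at h3
    have h4 : K * ‖w s‖ ≤ K * ω := by gcongr; exact hwω s (ha.trans hs)
    dsimp only at h1
    linarith

/-- Between two updates, the mismatch between the held and the current observer state is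
bounded by a relative and an absolute term. -/
theorem norm_est_sub_le_of_lt_nextTrigger {K : ℝ} (hK : 0 ≤ K)
    (hΨ : ∀ (x : Vec nx) (z : JointState nx) (w : Vec nw),
      ‖jointField S G (feedback S G x) z w‖ ≤ K * (‖x‖ + ‖z‖ + ‖w‖))
    {h τ σ ε ω a s : ℝ} (hh : h = ‖JointState.estL nx‖) (hτ : 0 < τ) (hσ : 0 < σ)
    (hτ1 : 4 * τ * K * (h + 1) ≤ 1) (hτσ : 4 * τ * K * (h + 1) ≤ σ)
    (hτε : 4 * τ * K * (h + 1) * ω ≤ ε) {w : ℝ → Vec nw} (hw : ∀ r, a ≤ r → ‖w r‖ ≤ ω)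
    {ζ : ℝ → JointState nx}
    (hζ : SolvesFrom (fun s y => jointField S G (feedback S G (ζ a).est) y (w s)) a ζ)
    (has : a ≤ s)
    (hs : (s : EReal) < nextTrigger τ σ ε a (ζ a).est (fun s => (ζ s).est)) :
    ‖(ζ a).est - (ζ s).est‖ ≤ (h + 1) * σ * ‖ζ s‖ + ε := by
  have hh0 : 0 ≤ h := hh ▸ norm_nonneg _
  have hω : 0 ≤ ω := (norm_nonneg _).trans (hw a le_rfl)
  -- Up to `a + τ` only the drift bound is available; from then on the rule has not fired.
  rcases le_total s (a + τ) with hsτ | hsτ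
  · subst hh
    have h1 : ‖ζ s - ζ a‖ ≤ 4 * τ * K * ((‖JointState.estL nx‖ + 1) * ‖ζ s‖ + ω) :=
      SolvesFrom.norm_sub_le_of_short_time (H := JointState.estL nx)
        (Ψ := fun x z w => jointField S G (feedback S G x) z w) hK hΨ hτ.le hτ1 hw hζ ⟨has, hsτ⟩
    have h2 : ‖(ζ a).est - (ζ s).est‖ ≤ ‖JointState.estL nx‖ * ‖ζ s - ζ a‖ := by
      have h3 := (JointState.estL nx).le_opNorm (ζ a - ζ s)
      rw [map_sub, norm_sub_rev (ζ a)] at h3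
      exact h3
    set h := ‖JointState.estL nx‖
    calc ‖(ζ a).est - (ζ s).est‖ ≤ h * ‖ζ s - ζ a‖ := h2
      _ ≤ (h + 1) * (4 * τ * K * ((h + 1) * ‖ζ s‖ + ω)) := by
          gcongr
          linarith
      _ = (h + 1) * (4 * τ * K * (h + 1)) * ‖ζ s‖ + 4 * τ * K * (h + 1) * ω := by ring
      _ ≤ (h + 1) * σ * ‖ζ s‖ + ε := by gcongr
  · refine (norm_sub_le_of_lt_nextTrigger hsτ hs).trans (add_le_add_left ?_ _)
    have h1 : ‖(ζ s).est‖ ≤ h * ‖ζ s‖ := hh ▸ (JointState.estL nx).le_opNorm (ζ s)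
    have h2 : σ * ‖(ζ s).est‖ ≤ σ * (h * ‖ζ s‖) := by gcongr
    have h3 : 0 ≤ σ * ‖ζ s‖ := by positivity
    linarith

end SampledLoop

/-! ### From decay of `V` to the ISpS estimate -/

theorem norm_le_of_quadratic_decay {m M c μ κ₀ ω r₀ r s v₀ v : ℝ} (hm : 0 < m) (hM : 0 < M)
    (hc : 0 < c) (hμ : 0 < μ) (hκ₀ : 0 ≤ κ₀) (hω : 0 ≤ ω) (hr₀ : 0 ≤ r₀) (hv : m * r ^ 2 ≤ v)
    (hv₀ : v₀ ≤ M * r₀ ^ 2)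
    (hdecay : v - (μ * ω ^ 2 + κ₀) / c ≤ Real.exp (-(c * s)) * (v₀ - (μ * ω ^ 2 + κ₀) / c)) :
    r ≤ Real.sqrt (M / m) * r₀ * Real.exp (-(c / 2 * s)) + Real.sqrt (μ / (c * m)) * ω
      + Real.sqrt (κ₀ / (c * m)) := by
  have hsq : Real.exp (-(c * s)) = Real.exp (-(c / 2 * s)) ^ 2 := by
    rw [← Real.exp_nat_mul]
    congr 1
    push_cast
    ring
  have hE := Real.exp_pos (-(c * s))
  have hbound : m * r ^ 2 ≤ Real.exp (-(c * s)) * (M * r₀ ^ 2) + (μ * ω ^ 2 + κ₀) / c := by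
    have h1 := mul_le_mul_of_nonneg_left hv₀ hE.le
    have h2 : 0 ≤ Real.exp (-(c * s)) * ((μ * ω ^ 2 + κ₀) / c) := by positivity
    linarith
  have hβ₁ : (Real.sqrt (M / m) * r₀ * Real.exp (-(c / 2 * s))) ^ 2
      = Real.exp (-(c * s)) * (M * r₀ ^ 2) / m := by
    rw [mul_pow, mul_pow, Real.sq_sqrt (by positivity), hsq]
    ring
  have hβ₂ : (Real.sqrt (μ / (c * m)) * ω) ^ 2 = μ * ω ^ 2 / c / m := by
    rw [mul_pow, Real.sq_sqrt (by positivity)]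
    field_simp
  have hd : Real.sqrt (κ₀ / (c * m)) ^ 2 = κ₀ / c / m := by
    rw [Real.sq_sqrt (by positivity)]
    field_simp
  have h1 : r ^ 2 ≤ (Real.sqrt (M / m) * r₀ * Real.exp (-(c / 2 * s))) ^ 2
      + (Real.sqrt (μ / (c * m)) * ω) ^ 2 + Real.sqrt (κ₀ / (c * m)) ^ 2 := by
    rw [hβ₁, hβ₂, hd, ← add_div, ← add_div, le_div_iff₀ hm]
    refine (le_of_eq (mul_comm _ _)).trans (hbound.trans (le_of_eq ?_))
    ring
  have hb1 : 0 ≤ Real.sqrt (M / m) * r₀ * Real.exp (-(c / 2 * s)) := by positivity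
  have hb2 : 0 ≤ Real.sqrt (μ / (c * m)) * ω := by positivity
  have hb3 := Real.sqrt_nonneg (κ₀ / (c * m))
  -- A sum of squares of nonnegative numbers is at most the square of their sum.
  refine le_of_pow_le_pow_left₀ two_ne_zero (by positivity) ?_
  nlinarith [mul_nonneg hb1 hb2, mul_nonneg hb1 hb3, mul_nonneg hb2 hb3]

theorem theorem3 (nx nu ny nq np nw : ℕ)
    (S : Plant nx nu ny nq np nw) (G : Gains nx nu ny nq np)
    (P : Matrix (Fin nx ⊕ Fin nx) (Fin nx ⊕ Fin nx) ℝ) (α₀ μ ω₀ : ℝ)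
    (hp0 : S.p 0 = 0) (hpLip : ∃ ℓ : NNReal, LipschitzWith ℓ S.p)
    (hα₀ : 0 < α₀) (hμ : 0 < μ) (hω₀ : 0 < ω₀) (hP : P.PosDef)
    (hV : ∀ (z : JointState nx) (w : Vec nw), ‖w‖ ≤ ω₀ →
      fderiv ℝ (quadForm P) z (closedLoopField S G z w)
        ≤ -α₀ * quadForm P z + μ * ‖w‖ ^ 2) :
    ∃ σ₀ : ℝ, 0 < σ₀ ∧ ∀ σ : ℝ, 0 < σ → σ ≤ σ₀ → ∀ ε : ℝ, 0 < ε →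
      ∃ τ₀ : ℝ, 0 < τ₀ ∧ ∀ τ : ℝ, 0 < τ → τ ≤ τ₀ →
        IsISpS (boundedDisturbances nw ω₀)
          (fun w z => ∃ t : ℕ → EReal, IsEventTriggeredTrajectory S G τ σ ε w z t) ∧
        ∀ w ∈ boundedDisturbances nw ω₀, ∀ (z : ℝ → JointState nx) (t : ℕ → EReal),
          IsEventTriggeredTrajectory S G τ σ ε w z t →
            (∀ k, t k + (τ : EReal) ≤ t (k + 1)) ∧ Tendsto t atTop (𝓝 ⊤) := by
  obtain ⟨K, hKlip⟩ := isLip_jointField_feedback S G hpLip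
  obtain ⟨m, hm, hVm⟩ := exists_mul_norm_sq_le_quadForm hP
  set N : ℝ := 2 * ‖Matrix.toEuclideanCLM (n := Fin nx ⊕ Fin nx) (𝕜 := ℝ) P‖ with hN_def
  have hN : 0 ≤ N := by positivity
  set h : ℝ := ‖JointState.estL nx‖ with hh
  have hh0 : 0 ≤ h := norm_nonneg _
  have hK0 : (0 : ℝ) ≤ K := K.2
  have hgrow : ∀ (x : Vec nx) (z : JointState nx) (w : Vec nw),
      ‖jointField S G (feedback S G x) z w‖ ≤ K * (‖x‖ + ‖z‖ + ‖w‖) := by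
    intro x z w
    have h1 := hKlip.norm_sub_le (x, z, w) (0, 0, 0)
    simp only [jointField_feedback_zero S G hp0, sub_zero, Prod.mk_sub_mk] at h1
    refine h1.trans (mul_le_mul_of_nonneg_left ?_ hK0)
    simp only [Prod.norm_def, sup_le_iff]
    have := norm_nonneg x
    have := norm_nonneg z
    have := norm_nonneg w
    refine ⟨?_, ?_, ?_⟩ <;> linarith
  have hdiff : ∀ (x y : Vec nx) (z : JointState nx) (w : Vec nw),
      ‖jointField S G (feedback S G x) z w - jointField S G (feedback S G y) z w‖
        ≤ K * ‖x - y‖ := by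
    intro x y z w
    simpa [Prod.norm_def] using hKlip.norm_sub_le (x, z, w) (y, z, w)
  -- Solved from `4 N K (h + 1) σ ≤ α₀ m`; the extra `1` keeps the denominator positive when `N K =
  -- 0`.
  refine ⟨α₀ * m / (4 * (N * K * (h + 1) + 1)), by positivity, fun σ hσ hσ₀ ε hε => ?_⟩
  have hδ : 4 * (N * K * ((h + 1) * σ)) ≤ α₀ * m := by
    rw [le_div_iff₀ (by positivity)] at hσ₀
    linarith
  -- The factor `ω₀ + 1` dominates both `1` and `ω₀`, so one bound provides all three smallness
  -- conditions on `τ`.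
  refine ⟨min 1 (min σ ε) / (4 * (K + 1) * (h + 1) * (ω₀ + 1)), by positivity,
    fun τ hτ hτ₀ => ?_⟩
  have hτmin : 4 * τ * K * (h + 1) * (ω₀ + 1) ≤ min 1 (min σ ε) := by
    rw [le_div_iff₀ (by positivity)] at hτ₀
    refine le_trans ?_ hτ₀
    have : 0 ≤ τ * (h + 1) * (ω₀ + 1) := by positivity
    linarith
  have hτ' : 0 ≤ 4 * τ * K * (h + 1) := by positivity
  have hτle : 4 * τ * K * (h + 1) ≤ min 1 (min σ ε) :=
    (le_mul_of_one_le_right hτ' (by linarith)).trans hτmin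
  have hτ1 : 4 * τ * K * (h + 1) ≤ 1 := hτle.trans (min_le_left _ _)
  have hτσ : 4 * τ * K * (h + 1) ≤ σ := hτle.trans ((min_le_right _ _).trans (min_le_left _ _))
  have hτε : 4 * τ * K * (h + 1) * ω₀ ≤ ε := by
    refine le_trans ?_ (hτmin.trans ((min_le_right _ _).trans (min_le_right _ _)))
    exact mul_le_mul_of_nonneg_left (by linarith) hτ'
  set c : ℝ := α₀ / 2 with hc_def
  have hc : 0 < c := by positivity
  set κ₀ : ℝ := (N * K * ε) ^ 2 / (α₀ * m) with hκ₀
  have hκ₀0 : 0 ≤ κ₀ := by positivity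
  refine ⟨?_, fun w _ z t ht => ⟨fun k => ht.dwell_of_nonneg k (ht.nonneg hτ k),
    tendsto_top_of_dwell hτ (ht.nat_mul_le hτ)⟩⟩
  -- `N + 1` replaces `N` so that the coefficient in `β₁` is positive; the offset `d` comes from the
  -- `ε`-term `κ₀` alone.
  refine ⟨fun r s => Real.sqrt ((N + 1) / m) * r * Real.exp (-(c / 2 * s)),
    fun r => Real.sqrt (μ / (c * m)) * r, Real.sqrt (κ₀ / (c * m)),
    isClassKL_mul_exp (by positivity) (by positivity), isClassK_mul_left (by positivity),
    Real.sqrt_nonneg _, fun z₀ w hw => ⟨?_, ?_⟩⟩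
  · exact exists_isEventTriggeredTrajectory hτ (fun a z₁ ha =>
      exists_solvesFrom_heldInput hpLip hw.1 hw.2 a ha z₁.est z₁) z₀
  rintro z rfl ⟨t, ht⟩ s hs
  set ω := supNorm w with hω_def
  have hwω : ∀ r, 0 ≤ r → ‖w r‖ ≤ ω := fun r hr => norm_le_supNorm hw.2 hr
  have hω0 : 0 ≤ ω := (norm_nonneg _).trans (hwω 0 le_rfl)
  have hωω₀ : ω ≤ ω₀ := supNorm_le hw.2
  set κ := μ * ω ^ 2 + κ₀ with hκ
  have hκ0 : 0 ≤ κ := by positivity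
  have hdecay := ht.exp_decay hτ (Y := fun y => quadForm P y - κ / c) (c := c) (by
    intro a b ζ ha hab hζ hb
    -- A bound on the piece bounds the velocity, as the decay lemma requires.
    obtain ⟨R, hR⟩ := isCompact_Icc.exists_bound_of_continuousOn (hζ.continuousOn hab)
    refine hζ.exp_decay hab (M := K * (‖(ζ a).est‖ + R + ω)) (fun r hr => ?_)
      (contDiff_quadForm P) hc (fun r hr => ?_)
    · refine (hgrow _ _ _).trans (mul_le_mul_of_nonneg_left ?_ hK0)
      linarith [hR r hr, hwω r (ha.trans hr.1)]
    · have hr0 : 0 ≤ r := ha.trans hr.1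
      -- The mismatch uses the uniform bound `ω₀`, since `τ₀` may not depend on `w`; the gain in `κ`
      -- uses the actual `supNorm w`.
      have hmis := norm_est_sub_le_of_lt_nextTrigger hK0 hgrow hh hτ hσ hτ1 hτσ hτε
        (fun r hr => hw.2 r (ha.trans hr)) hζ hr.1
        (lt_of_lt_of_le (EReal.coe_lt_coe_iff.2 hr.2) hb)
      refine dissipation_of_perturbed (Ψ := fun x z w => jointField S G (feedback S G x) z w)
        hK0 hm hα₀ hN (hdiff _ _ _ _) (hVm _) (norm_fderiv_quadForm_le P _)
        ((hV (ζ r) (w r) (hw.2 r hr0)).trans ?_) hmis hδ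
      have : ‖w r‖ ^ 2 ≤ ω ^ 2 := by gcongr; exact hwω r hr0
      gcongr) hs
  refine norm_le_of_quadratic_decay hm (by positivity) hc hμ hκ₀0 hω0 (norm_nonneg _)
    (hVm (z s)) ?_ hdecay
  refine (quadForm_le P (z 0)).trans (mul_le_mul_of_nonneg_right ?_ (by positivity))
  have := norm_nonneg (Matrix.toEuclideanCLM (n := Fin nx ⊕ Fin nx) (𝕜 := ℝ) P)
  linarith
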